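/- A $k$-current in $\mathbb{R}^2$ is a continuous linear functional on the space of smooth compactly supported $k$-forms; its boundary is $(\partial S)(\omega)=S(d\omega)$, and its mass ($k$-dimensional volume) is $\mathbf{V}_k(T)=\sup\{T(\omega): \|\omega(x)\|\le 1 \text{ for all } x\}$ (comass norm). The multiscale flat norm of a 1-current $T$ at scale $\lambda$ is $$\mathbb{F}_\lambda(T)=\inf_{S}\{\mathbf{V}_1(T-\partial S)+\lambda\,\mathbf{V}_2(S)\},$$ the infimum being over all 2-currents $S$ in $\mathbb{R}^2$. For $s,t\in\mathbb{R}^2$ let $\mathcal{L}_n[s,t]$ be the set of simple piecewise linear curves with nodes $v_0=s,v_1,\dots,v_n=t$ and nondegenerate straight edges $e_i=(v_{i-1},v_i)$, $1\le i\le n$, such that $e_i\cap e_{i+1}=\{v_i\}$ and non-consecutive edges are disjoint. Such a curve $T$ is identified with the 1-current $e_1+\dots+e_n$, where $e_i$ stands for integration along the oriented segment. For $i<j$ let $T[v_i,v_j]=e_{i+1}+\dots+e_j$, and let the length $|\cdot|$ be the sum of the Euclidean lengths of the edges. **Theorem.** Let $n\ge 2$, $T_0\in\mathcal{L}_n[s,t]$,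 and let $T_1=T_0$ be its copy. Let $\lambda>0$ and $\delta>0$. Let $v=v_i$, $1\le i\le n-1$, be an interior node with neighbours $u=v_{i-1}$ and $w=v_{i+1}$. Let $\tilde v$ be a point with $\|\tilde v-v\|<\delta$ such that the new edges do not meet the original curve except where they are attached to it, i.e. the closed segments satisfy $[u,\tilde v]\cap T_1=\{u\}$ and $[\tilde v,w]\cap T_1=\{w\}$. Let $\tilde T_1$ be the piecewise linear current obtained from $T_1$ by replacing the node $v$ by $\tilde v$ and the edges $(u,v),(v,w)$ by $(u,\tilde v),(\tilde v,w)$. Then $$\mathbb{F}_\lambda(\tilde T_1-T_0)\;\le\;\frac{\lambda\delta}{2}\,\big|T_0[u,w]\big| .$$ The same bound holds if, in the definition of $\mathbb{F}_\lambda$, the competitors $S$ are restricted to 2-currents $S(\omega)=\int_{\mathbb{R}^2} f(x)\,\omega_x(e_1,e_2)\,dx$, where $(e_1,e_2)$ is the standard basis of $\mathbb{R}^2$ and $f:\mathbb{R}^2\to\mathbb{Z}$ is integrable (integer multiplicities). -/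

import Mathlib

open MeasureTheory TopologicalSpace
open scoped ENNReal BoundedContinuousFunction

noncomputable section

/-- The Euclidean plane. -/
abbrev Plane : Type := EuclideanSpace ℝ (Fin 2)

/-- Alternating `k`-covectors of the plane. Their norm is the operator norm
`sup |ω(x₁, …, x_k)| / (‖x₁‖ ⋯ ‖x_k‖)`, which for a Euclidean space is the comass norm. -/
abbrev Covector (k : ℕ) : Type := Plane [⋀^Fin k]→L[ℝ] ℝ

/-- Smooth compactly supported differential `k`-forms on the plane, with the usual
LF-topology of test functions. -/
abbrev TestForm (k : ℕ) : Type := TestFunction (⊤ : Opens Plane) (Covector k) (⊤ : ℕ∞)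

/-- The `k`-currents in the plane: continuous linear functionals on test `k`-forms. -/
abbrev Current (k : ℕ) : Type := TestForm k →L[ℝ] ℝ

/-- The exterior derivative of test forms. -/
def TestForm.d (k : ℕ) : TestForm k →L[ℝ] TestForm (k + 1) :=
  (TestFunction.postcompCLM
      (ContinuousAlternatingMap.alternatizeUncurryFinCLM ℝ Plane ℝ (n := k))).comp
    (TestFunction.fderivCLM ℝ (⊤ : ℕ∞) (⊤ : ℕ∞))

theorem TestForm.d_apply {k : ℕ} (ω : TestForm k) (x : Plane) :
    TestForm.d k ω x = extDeriv ω x := by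
  simp [TestForm.d, extDeriv]

namespace Current

/-- The boundary of a current, `(∂S)(ω) = S(dω)`. -/
def boundary {k : ℕ} (S : Current (k + 1)) : Current k := S.comp (TestForm.d k)

/-- The mass (`k`-dimensional volume) of a current:
the supremum of its values on the forms of comass at most one. -/
def mass {k : ℕ} (T : Current k) : ℝ≥0∞ :=
  ⨆ (ω : TestForm k) (_ : ∀ x, ‖ω x‖ ≤ 1), ENNReal.ofReal (T ω)

/-- The multiscale flat norm at scale `lam`: the infimum over all `(k+1)`-currents `S` of
`V_k (T - ∂S) + lam * V_{k+1} (S)`. -/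
def flatNorm {k : ℕ} (lam : ℝ) (T : Current k) : ℝ≥0∞ :=
  ⨅ S : Current (k + 1), mass (T - boundary S) + ENNReal.ofReal lam * mass S

/-- The current `[[a, b]]` of integration along the oriented segment from `a` to `b`. -/
def edge (a b : Plane) : Current 1 :=
  (LinearMap.mkContinuous
    { toFun := fun φ : Plane →ᵇ Covector 1 =>
        ∫ r in (0 : ℝ)..1, φ (AffineMap.lineMap a b r) (fun _ => b - a)
      map_add' := fun φ ψ => by
        have h : ∀ χ : Plane →ᵇ Covector 1, IntervalIntegrable
            (fun r : ℝ => χ (AffineMap.lineMap a b r) (fun _ => b - a)) volume 0 1 :=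
          fun χ => Continuous.intervalIntegrable
            ((ContinuousAlternatingMap.apply ℝ Plane ℝ (fun _ : Fin 1 => b - a)).continuous.comp
              (χ.continuous.comp AffineMap.lineMap_continuous)) _ _
        simpa using intervalIntegral.integral_add (h φ) (h ψ)
      map_smul' := fun c φ => by simp }
    ‖b - a‖
    (fun φ => by
      have h := intervalIntegral.norm_integral_le_of_norm_le_const (a := (0 : ℝ)) (b := 1)
        (C := ‖b - a‖ * ‖φ‖)
        (f := fun r : ℝ => φ (AffineMap.lineMap a b r) (fun _ => b - a))
        (fun r _ => by
          have h1 := (φ (AffineMap.lineMap a b r)).le_opNorm (fun _ => b - a)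
          have h2 := φ.norm_coe_le_norm (AffineMap.lineMap a b r)
          simp only [Finset.univ_unique, Finset.prod_singleton] at h1
          nlinarith [norm_nonneg (b - a)])
      simpa using h)).comp
  (TestFunction.toBoundedContinuousFunctionCLM ℝ)

theorem edge_apply (a b : Plane) (ω : TestForm 1) :
    edge a b ω = ∫ r in (0 : ℝ)..1, ω (AffineMap.lineMap a b r) (fun _ => b - a) := rfl

/-- The polygonal 1-current `e₁ + ⋯ + eₙ` of the node sequence `v₀, …, vₙ`, where `eᵢ` is the
edge from `vᵢ₋₁` to `vᵢ`. -/
def polyline {n : ℕ} (v : Fin (n + 1) → Plane) : Current 1 :=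
  ∑ i : Fin n, edge (v i.castSucc) (v i.succ)

/-- The standard positively oriented frame `(e₁, e₂)` of the plane. -/
def frame : Fin 2 → Plane := fun i => EuclideanSpace.single i 1

/-- The integer multiplicity 2-current `f · [[ℝ²]]`, `ω ↦ ∫ f ⟨ω, e₁ ∧ e₂⟩`, of an integrable
integer-valued function `f`; these are all the integer multiplicity rectifiable 2-currents of
finite mass in the plane. -/
def ofMultiplicity (f : Plane → ℤ) (hf : Integrable (fun x => (f x : ℝ))) : Current 2 :=
  (LinearMap.mkContinuous
    { toFun := fun φ : Plane →ᵇ Covector 2 => ∫ x, (f x : ℝ) * φ x frame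
      map_add' := fun φ ψ => by
        have h : ∀ χ : Plane →ᵇ Covector 2, Integrable (fun x => (f x : ℝ) * χ x frame) := by
          intro χ
          refine hf.mul_bdd (c := ‖χ‖ * ∏ i, ‖frame i‖)
            ((ContinuousAlternatingMap.apply ℝ Plane ℝ frame).continuous.comp
              χ.continuous).aestronglyMeasurable (Filter.Eventually.of_forall fun x => ?_)
          exact (χ x).le_of_opNorm_le (χ.norm_coe_le_norm x) frame
        simpa [mul_add] using integral_add (h φ) (h ψ)
      map_smul' := fun c φ => by
        simp only [BoundedContinuousFunction.coe_smul, ContinuousAlternatingMap.smul_apply,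
          smul_eq_mul, RingHom.id_apply]
        rw [← integral_const_mul]
        congr 1
        ext x
        ring }
    (∫ x, ‖(f x : ℝ)‖)
    (fun φ => by
      have h : ∀ x, ‖(f x : ℝ) * φ x frame‖ ≤ ‖(f x : ℝ)‖ * ‖φ‖ := by
        intro x
        rw [norm_mul]
        refine mul_le_mul_of_nonneg_left ?_ (norm_nonneg _)
        simpa [frame] using (φ x).le_of_opNorm_le (φ.norm_coe_le_norm x) frame
      have h' := norm_integral_le_of_norm_le (hf.norm.mul_const ‖φ‖)
        (Filter.Eventually.of_forall h)
      rwa [integral_mul_const] at h')).comp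
  (TestFunction.toBoundedContinuousFunctionCLM ℝ)

theorem ofMultiplicity_apply (f : Plane → ℤ) (hf : Integrable (fun x => (f x : ℝ)))
    (ω : TestForm 2) : ofMultiplicity f hf ω = ∫ x, (f x : ℝ) * ω x frame := rfl

/-- The multiscale flat norm of a 1-current when the competitors `S` are restricted to the
2-currents with integer multiplicities. -/
def integerFlatNorm (lam : ℝ) (T : Current 1) : ℝ≥0∞ :=
  ⨅ (f : Plane → ℤ) (hf : Integrable (fun x => (f x : ℝ))),
    mass (T - boundary (ofMultiplicity f hf)) + ENNReal.ofReal lam * mass (ofMultiplicity f hf)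

end Current

/-- `PWL n s t` is the set `𝓛ₙ[s, t]` of simple piecewise linear curves in the plane with `n`
edges from `s` to `t`: consecutive edges meet exactly in their common node, and all other pairs of
edges are disjoint. -/
structure PWL (n : ℕ) (s t : Plane) where
  /-- The nodes `v₀, …, vₙ`. -/
  node : Fin (n + 1) → Plane
  node_zero : node 0 = s
  node_last : node (Fin.last n) = t
  edge_nondegenerate : ∀ i : Fin n, node i.castSucc ≠ node i.succ
  edge_inter_next : ∀ i j : Fin n, (i : ℕ) + 1 = j →
    segment ℝ (node i.castSucc) (node i.succ) ∩ segment ℝ (node j.castSucc) (node j.succ)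
      = {node j.castSucc}
  edge_disjoint : ∀ i j : Fin n, (i : ℕ) + 1 < j →
    Disjoint (segment ℝ (node i.castSucc) (node i.succ))
      (segment ℝ (node j.castSucc) (node j.succ))

namespace PWL

variable {n : ℕ} {s t : Plane}

/-- The 1-current of the curve: the formal sum of its edges. -/
def toCurrent (T : PWL n s t) : Current 1 := Current.polyline T.node

/-- The set of points of the curve. -/
def carrier (T : PWL n s t) : Set Plane :=
  ⋃ i : Fin n, segment ℝ (T.node i.castSucc) (T.node i.succ)

/-- The length `|T| = |e₁| + ⋯ + |eₙ|`. -/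
def length (T : PWL n s t) : ℝ := ∑ i : Fin n, dist (T.node i.castSucc) (T.node i.succ)

/-- The subcurrent `T[vᵢ, vⱼ]` for `i ≤ j`, with the edges `eᵢ₊₁, …, eⱼ`. -/
def sub (T : PWL n s t) (i j : Fin (n + 1)) (hij : i ≤ j) :
    PWL ((j : ℕ) - i) (T.node i) (T.node j) where
  node k := T.node ⟨i + k, by have := Fin.le_def.1 hij; omega⟩
  node_zero := by simp
  node_last := by
    have := Fin.le_def.1 hij
    congr 1
    ext
    simp only [Fin.val_last]
    omega
  edge_nondegenerate k := by
    have := Fin.le_def.1 hij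
    exact T.edge_nondegenerate ⟨i + k, by omega⟩
  edge_inter_next k l hkl := by
    have := Fin.le_def.1 hij
    exact T.edge_inter_next ⟨i + k, by omega⟩ ⟨i + l, by omega⟩ (by simp only; omega)
  edge_disjoint k l hkl := by
    have := Fin.le_def.1 hij
    exact T.edge_disjoint ⟨i + k, by omega⟩ ⟨i + l, by omega⟩ (by simp only; omega)

/-- The allowed region of a `δ`-perturbation of the interior node `v` with neighbours `u` and `w`:
the points `x` of the open `δ`-ball around `v` such that the new edges `(u, x)` and `(x, w)` do not
meet the curve, except in the old nodes `u` and `w` to which they are attached. -/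
def allowedRegion (T : PWL n s t) (u v w : Fin (n + 1)) (δ : ℝ) : Set Plane :=
  {x | x ∈ Metric.ball (T.node v) δ ∧
    segment ℝ (T.node u) x ∩ T.carrier = {T.node u} ∧
    segment ℝ x (T.node w) ∩ T.carrier = {T.node w}}

/-- The current obtained by moving the node `v` to `x`, together with the edges at `v`. -/
def perturbedCurrent (T : PWL n s t) (v : Fin (n + 1)) (x : Plane) : Current 1 :=
  Current.polyline (Function.update T.node v x)

end PWL

end

/-! Moving `v` to `v'` changes only the two edges at `v`, so the difference of the currents is the
closed quadrilateral `u → v' → w → v → u`. It bounds the sum of the oriented triangles `(v, u, v')`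
and `(v, v', w)`, whose common side cancels. Taking this sum as competitor `S` leaves no mass in `T
- ∂S`. Each triangle has area at most half of `‖v' - v‖` times the length of an old edge, which
gives the bound. The multiplicities are signed indicators, so `S` has integer multiplicity and one
competitor serves both infima. The weight lies in `Current.boundary_triangle`, Stokes' formula
obtained by pulling back to the standard simplex, and in `integral_abs_triangleMult`, the area.
Orientation signs let degenerate and overlapping triangles be treated uniformly. -/

noncomputable section

/-! ### Plane determinants and 2-covectors -/

/-- The standard 2-simplex `{0 ≤ p, 0 ≤ q, p + q ≤ 1}`. -/
def planeSimplex : Set Plane := {x | 0 ≤ x 0 ∧ 0 ≤ x 1 ∧ x 0 + x 1 ≤ 1}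

/-- The determinant of a pair of plane vectors. -/
def planeCross (p q : Plane) : ℝ := p 0 * q 1 - p 1 * q 0

/-- Lagrange's identity: the squares of the two sides differ by the square of the inner product. -/
theorem abs_planeCross_le (p q : Plane) : |planeCross p q| ≤ ‖p‖ * ‖q‖ := by
  rw [← abs_of_nonneg (mul_nonneg (norm_nonneg p) (norm_nonneg q))]
  apply sq_le_sq.1
  rw [mul_pow, EuclideanSpace.real_norm_sq_eq, EuclideanSpace.real_norm_sq_eq, planeCross]
  simp only [Fin.sum_univ_two]
  nlinarith [sq_nonneg (p 0 * q 0 + p 1 * q 1)]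

/-- Top-degree alternating forms are multiples of the determinant. This lets the Jacobian of a
triangle's parametrization be absorbed into the arguments of the form. -/
theorem Covector.apply_pair (φ : Covector 2) (p q : Plane) :
    φ ![p, q] = planeCross p q * φ Current.frame := by
  have h := congrArg (fun ψ : Plane [⋀^Fin 2]→ₗ[ℝ] ℝ => ψ ![p, q])
    (AlternatingMap.eq_smul_basis_det (EuclideanSpace.basisFun (Fin 2) ℝ).toBasis
      φ.toAlternatingMap)
  have hf : ((EuclideanSpace.basisFun (Fin 2) ℝ).toBasis : Fin 2 → Plane) = Current.frame := by
    ext i : 1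
    simp [Current.frame]
  simp only [AlternatingMap.smul_apply, Module.Basis.det_apply, Matrix.det_fin_two,
    Module.Basis.toMatrix_apply, hf, smul_eq_mul] at h
  simp only [OrthonormalBasis.coe_toBasis_repr_apply, EuclideanSpace.basisFun_repr] at h
  simp only [Matrix.cons_val_zero, Matrix.cons_val_one] at h
  refine h.trans ?_
  change φ Current.frame * _ = _
  rw [planeCross]
  ring

/-- The linear map of the plane with columns `p` and `q`. -/
def planeLin (p q : Plane) : Plane →L[ℝ] Plane :=
  (EuclideanSpace.proj (0 : Fin 2) : Plane →L[ℝ] ℝ).smulRight p +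
    (EuclideanSpace.proj (1 : Fin 2) : Plane →L[ℝ] ℝ).smulRight q

theorem planeLin_apply (p q x : Plane) : planeLin p q x = x 0 • p + x 1 • q := rfl

theorem planeLin_det (p q : Plane) : (planeLin p q).det = planeCross p q := by
  have h := LinearMap.det_toMatrix (EuclideanSpace.basisFun (Fin 2) ℝ).toBasis
    (planeLin p q : Plane →ₗ[ℝ] Plane)
  rw [ContinuousLinearMap.det, ← h, Matrix.det_fin_two]
  simp [LinearMap.toMatrix_apply, planeLin_apply, planeCross]
  ring

/-! ### Triangles and their signed multiplicities -/

/-- The affine parametrization of the triangle with vertices `a`, `b`, `c`. -/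
def trianglePar (a b c x : Plane) : Plane := a + planeLin (b - a) (c - a) x

/-- The solid triangle with vertices `a`, `b`, `c`. -/
def solidTriangle (a b c : Plane) : Set Plane := trianglePar a b c '' planeSimplex

theorem trianglePar_continuous (a b c : Plane) : Continuous (trianglePar a b c) := by
  unfold trianglePar
  fun_prop

theorem isCompact_planeSimplex : IsCompact planeSimplex := by
  apply Metric.isCompact_of_isClosed_isBounded
  · refine IsClosed.and ?_ (IsClosed.and ?_ ?_)
    · exact isClosed_le (by fun_prop) (by fun_prop)
    · exact isClosed_le (by fun_prop) (by fun_prop)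
    · exact isClosed_le (by fun_prop) (by fun_prop)
  · refine Metric.isBounded_closedBall (x := (0 : Plane)) (r := 1) |>.subset ?_
    rintro x ⟨h0, h1, h2⟩
    rw [mem_closedBall_zero_iff, ← sq_le_one_iff₀ (norm_nonneg _), EuclideanSpace.real_norm_sq_eq,
      Fin.sum_univ_two]
    nlinarith

theorem isCompact_solidTriangle (a b c : Plane) : IsCompact (solidTriangle a b c) :=
  isCompact_planeSimplex.image (trianglePar_continuous a b c)

theorem setIntegral_solidTriangle {a b c : Plane} (h : planeCross (b - a) (c - a) ≠ 0)
    (g : Plane → ℝ) :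
    ∫ x in solidTriangle a b c, g x =
      |planeCross (b - a) (c - a)| * ∫ x in planeSimplex, g (trianglePar a b c x) := by
  have hd : (planeLin (b - a) (c - a)).det ≠ 0 := by rwa [planeLin_det]
  have hinj : Function.Injective (trianglePar a b c) := by
    intro x y hxy
    have := add_left_cancel hxy
    exact (LinearMap.equivOfDetNeZero _ hd).injective this
  rw [solidTriangle, integral_image_eq_integral_abs_det_fderiv_smul volume
    isCompact_planeSimplex.measurableSet
    (f := trianglePar a b c)
    (fun x _ => ((planeLin (b - a) (c - a)).hasFDerivAt.const_add a).hasFDerivWithinAt)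
    hinj.injOn, planeLin_det]
  simp only [smul_eq_mul]
  rw [integral_const_mul]

/-- The signed indicator of the oriented triangle `a`, `b`, `c`. -/
def triangleMult (a b c : Plane) : Plane → ℤ :=
  (solidTriangle a b c).indicator fun _ => (SignType.sign (planeCross (b - a) (c - a)) : ℤ)

theorem triangleMult_cast (a b c x : Plane) :
    (triangleMult a b c x : ℝ) = (solidTriangle a b c).indicator
      (fun _ => (SignType.sign (planeCross (b - a) (c - a)) : ℝ)) x := by
  by_cases hx : x ∈ solidTriangle a b c <;> simp [triangleMult, hx]

theorem integrable_triangleMult (a b c : Plane) :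
    Integrable fun x => (triangleMult a b c x : ℝ) := by
  simp only [triangleMult_cast]
  exact (integrable_indicator_iff (isCompact_solidTriangle a b c).measurableSet).2
    (integrableOn_const (isCompact_solidTriangle a b c).measure_lt_top.ne)

/-- The sign turns the absolute Jacobian into the signed one. For a degenerate triangle the sign is
`0` and both sides vanish, so no nondegeneracy is needed. -/
theorem integral_triangleMult_mul (a b c : Plane) (g : Plane → ℝ) :
    ∫ x, (triangleMult a b c x : ℝ) * g x =
      planeCross (b - a) (c - a) * ∫ x in planeSimplex, g (trianglePar a b c x) := by
  have h1 : ∀ x, (triangleMult a b c x : ℝ) * g x = (solidTriangle a b c).indicator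
      (fun x => (SignType.sign (planeCross (b - a) (c - a)) : ℝ) * g x) x := by
    intro x
    rw [triangleMult_cast]
    by_cases hx : x ∈ solidTriangle a b c <;> simp [hx]
  simp only [h1]
  rw [integral_indicator (isCompact_solidTriangle a b c).measurableSet, integral_const_mul]
  by_cases h : planeCross (b - a) (c - a) = 0
  · simp [h]
  · rw [setIntegral_solidTriangle h, ← mul_assoc, sign_mul_abs]

/-! ### Fubini and Green's formula on the simplex -/

/-- The standard 2-simplex in `ℝ × ℝ`. -/
def pairSimplex : Set (ℝ × ℝ) := {z | 0 ≤ z.1 ∧ 0 ≤ z.2 ∧ z.1 + z.2 ≤ 1}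

theorem isCompact_pairSimplex : IsCompact pairSimplex := by
  refine (isCompact_Icc (a := ((0 : ℝ), (0 : ℝ))) (b := (1, 1))).of_isClosed_subset
    ((isClosed_le (by fun_prop) (by fun_prop)).and
    ((isClosed_le (by fun_prop) (by fun_prop)).and
      (isClosed_le (by fun_prop) (by fun_prop)))) ?_
  rintro ⟨p, q⟩ ⟨h0, h1, h2⟩
  simp only at h0 h1 h2
  exact ⟨⟨h0, h1⟩, ⟨by simp only; linarith, by simp only; linarith⟩⟩

theorem simplex_integral_eq (g : Plane → ℝ) :
    ∫ x in planeSimplex, g x =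
      ∫ z in pairSimplex, g !₂[z.1, z.2] := by
  have hm : MeasurePreserving (fun z : ℝ × ℝ => (!₂[z.1, z.2] : Plane)) :=
    ((PiLp.volume_preserving_toLp (Fin 2)).comp
      (volume_preserving_finTwoArrow ℝ).symm)
  have he : MeasurableEmbedding (fun z : ℝ × ℝ => (!₂[z.1, z.2] : Plane)) :=
    ((MeasurableEquiv.finTwoArrow (α := ℝ)).symm.trans
      (MeasurableEquiv.toLp 2 (Fin 2 → ℝ))).measurableEmbedding
  rw [← hm.setIntegral_preimage_emb he]
  rfl

theorem simplex_integral_fst {G : ℝ × ℝ → ℝ} (hG : Continuous G) :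
    ∫ z in pairSimplex, G z =
      ∫ p in (0 : ℝ)..1, ∫ q in (0 : ℝ)..(1 - p), G (p, q) := by
  have hcomp := isCompact_pairSimplex
  have hc := hcomp.isClosed
  have hint : Integrable (pairSimplex.indicator G) (volume.prod volume) :=
    (integrable_indicator_iff hc.measurableSet).2 (hG.continuousOn.integrableOn_compact hcomp)
  rw [← integral_indicator hc.measurableSet, Measure.volume_eq_prod, integral_prod _ hint,
    intervalIntegral.integral_of_le zero_le_one, ← integral_Icc_eq_integral_Ioc,
    ← integral_indicator measurableSet_Icc]
  congr 1
  ext p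
  by_cases hp : p ∈ Set.Icc (0 : ℝ) 1
  · rw [Set.indicator_of_mem hp, intervalIntegral.integral_of_le (by linarith [hp.2]),
      ← integral_Icc_eq_integral_Ioc, ← integral_indicator measurableSet_Icc]
    congr 1
    ext q
    have : (p, q) ∈ pairSimplex ↔ q ∈ Set.Icc 0 (1 - p) := by
      simp only [pairSimplex, Set.mem_ofPred_eq, Set.mem_Icc]
      constructor
      · rintro ⟨-, h1, h2⟩
        exact ⟨h1, by linarith⟩
      · rintro ⟨h1, h2⟩
        exact ⟨hp.1, h1, by linarith⟩
    by_cases hq : q ∈ Set.Icc 0 (1 - p)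
    · rw [Set.indicator_of_mem hq, Set.indicator_of_mem (this.2 hq)]
    · rw [Set.indicator_of_notMem hq, Set.indicator_of_notMem (fun h => hq (this.1 h))]
  · rw [Set.indicator_of_notMem hp]
    refine integral_eq_zero_of_ae (Filter.Eventually.of_forall fun q => ?_)
    refine Set.indicator_of_notMem (fun h => hp ?_) _
    obtain ⟨h0, h1, h2⟩ := h
    simp only at h0 h1 h2
    exact ⟨h0, by linarith⟩

theorem simplex_integral_snd {G : ℝ × ℝ → ℝ} (hG : Continuous G) :
    ∫ z in pairSimplex, G z =
      ∫ q in (0 : ℝ)..1, ∫ p in (0 : ℝ)..(1 - q), G (p, q) := by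
  have h := simplex_integral_fst (G := fun z => G z.swap) (by fun_prop)
  simp only [Prod.swap_prod_mk] at h
  rw [← h]
  have hm : MeasurePreserving (Prod.swap : ℝ × ℝ → ℝ × ℝ) := Measure.measurePreserving_swap
  rw [← hm.setIntegral_preimage_emb MeasurableEquiv.prodComm.measurableEmbedding]
  congr 2
  ext ⟨p, q⟩
  simp only [pairSimplex, Set.mem_preimage, Set.mem_ofPred_eq, Prod.swap_prod_mk]
  constructor <;> rintro ⟨h0, h1, h2⟩ <;> exact ⟨h1, h0, by linarith⟩

theorem integral_one_planeSimplex : ∫ _x in planeSimplex, (1 : ℝ) = 1 / 2 := by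
  rw [simplex_integral_eq, simplex_integral_fst continuous_const]
  simp only [intervalIntegral.integral_const, smul_eq_mul, mul_one, sub_zero]
  rw [intervalIntegral.integral_sub (by simp) (by simp)]
  norm_num

/-- Green's formula on the standard 2-simplex. -/
theorem simplex_green {P Q P' Q' : ℝ × ℝ → ℝ} (hP' : Continuous P') (hQ' : Continuous Q')
    (hP : Continuous P) (hQ : Continuous Q)
    (hPd : ∀ p q, HasDerivAt (fun q => P (p, q)) (P' (p, q)) q)
    (hQd : ∀ p q, HasDerivAt (fun p => Q (p, q)) (Q' (p, q)) p) :
    ∫ z in pairSimplex, (Q' z - P' z) =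
      (∫ r in (0 : ℝ)..1, P (r, 0)) + (∫ r in (0 : ℝ)..1, (Q (1 - r, r) - P (1 - r, r)))
        - ∫ r in (0 : ℝ)..1, Q (0, r) := by
  have hc := isCompact_pairSimplex
  have h1 : ∀ p, ∫ q in (0 : ℝ)..(1 - p), P' (p, q) = P (p, 1 - p) - P (p, 0) := fun p =>
    intervalIntegral.integral_eq_sub_of_hasDerivAt (fun q _ => hPd p q)
      (Continuous.intervalIntegrable (by fun_prop) _ _)
  have h2 : ∀ q, ∫ p in (0 : ℝ)..(1 - q), Q' (p, q) = Q (1 - q, q) - Q (0, q) := fun q =>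
    intervalIntegral.integral_eq_sub_of_hasDerivAt (fun p _ => hQd p q)
      (Continuous.intervalIntegrable (by fun_prop) _ _)
  -- Reversing the parameter puts both hypotenuse terms on the same path `(1 - r, r)`.
  have h3 : ∫ r in (0 : ℝ)..1, P (r, 1 - r) = ∫ r in (0 : ℝ)..1, P (1 - r, r) := by
    have := intervalIntegral.integral_comp_sub_left (a := 0) (b := 1)
      (fun r : ℝ => P (r, 1 - r)) 1
    simpa using this.symm
  rw [integral_sub (hQ'.continuousOn.integrableOn_compact hc)
    (hP'.continuousOn.integrableOn_compact hc), simplex_integral_fst hP', simplex_integral_snd hQ']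
  simp only [h1, h2]
  rw [intervalIntegral.integral_sub, intervalIntegral.integral_sub, intervalIntegral.integral_sub,
    h3]
  · ring
  all_goals exact Continuous.intervalIntegrable (by fun_prop) _ _

/-! ### Stokes' formula for triangles -/

theorem TestForm.d_apply_pair (ω : TestForm 1) (x p q : Plane) :
    TestForm.d 1 ω x ![p, q] =
      fderiv ℝ ω x p (fun _ => q) - fderiv ℝ ω x q (fun _ => p) := by
  rw [TestForm.d_apply, extDeriv, ContinuousAlternatingMap.alternatizeUncurryFin_apply]
  have h0 : Fin.removeNth 0 ![p, q] = fun _ : Fin 1 => q := by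
    ext i : 1; fin_cases i; rfl
  have h1 : Fin.removeNth 1 ![p, q] = fun _ : Fin 1 => p := by
    ext i : 1; fin_cases i; rfl
  simp [Fin.sum_univ_two, h0, h1, sub_eq_add_neg]

theorem trianglePar_pair (a b c : Plane) (p q : ℝ) :
    trianglePar a b c !₂[p, q] = a + (p • (b - a) + q • (c - a)) := rfl

theorem Current.edge_swap_apply (a b : Plane) (ω : TestForm 1) :
    Current.edge b a ω = -Current.edge a b ω := by
  have h := intervalIntegral.integral_comp_sub_left (a := 0) (b := 1)
      (fun r : ℝ => ω (AffineMap.lineMap b a r) (fun _ => a - b)) 1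
  rw [sub_zero, sub_self] at h
  rw [Current.edge_apply, Current.edge_apply, ← h, ← intervalIntegral.integral_neg]
  congr 1
  ext r
  rw [AffineMap.lineMap_apply_one_sub, ← ContinuousAlternatingMap.neg_apply, ← neg_sub b a]
  have := (ω (AffineMap.lineMap a b r)).toMultilinearMap.map_smul_univ
    (fun _ : Fin 1 => (-1 : ℝ)) (fun _ => b - a)
  simpa using this

theorem Current.edge_swap (a b : Plane) : Current.edge b a = -Current.edge a b := by
  ext ω
  exact Current.edge_swap_apply a b ω

/-- Stokes' formula for an oriented, possibly degenerate, triangle. -/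
theorem Current.boundary_triangle (a b c : Plane) :
    boundary (ofMultiplicity (triangleMult a b c) (integrable_triangleMult a b c)) =
      edge a b + edge b c + edge c a := by
  ext ω
  have hω : ContDiff ℝ (⊤ : ℕ∞) ω := ω.contDiff
  have hdiff : Differentiable ℝ ω := hω.differentiable (by simp)
  have hfc : Continuous (fderiv ℝ ω) := hω.continuous_fderiv (by simp)
  have hωc : Continuous ω := hω.continuous
  set e := b - a with he
  set f := c - a with hf
  set σ : ℝ × ℝ → Plane := fun z => a + (z.1 • e + z.2 • f) with hσ
  have hσc : Continuous σ := by fun_prop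
  have happ : ∀ p : Plane, Continuous fun φ : Covector 1 => φ (fun _ => p) := fun p =>
    (ContinuousAlternatingMap.apply ℝ Plane ℝ (fun _ : Fin 1 => p)).continuous
  have hder : ∀ p q : Plane, ∀ x : ℝ → Plane, ∀ t, HasDerivAt x p t →
      HasDerivAt (fun t => ω (x t) fun _ => q) (fderiv ℝ ω (x t) p fun _ => q) t := by
    intro p q x t hx
    exact (ContinuousAlternatingMap.apply ℝ Plane ℝ (fun _ : Fin 1 => q)).hasFDerivAt.comp_hasDerivAt
      t ((hdiff (x t)).hasFDerivAt.comp_hasDerivAt t hx)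
  -- `P` and `Q` are the components of the pullback of `ω` under the affine map `σ`.
  have hgreen := simplex_green (P := fun z => ω (σ z) fun _ => e) (Q := fun z => ω (σ z) fun _ => f)
    (P' := fun z => fderiv ℝ ω (σ z) f fun _ => e) (Q' := fun z => fderiv ℝ ω (σ z) e fun _ => f)
    ((happ e).comp ((hfc.comp hσc).clm_apply continuous_const))
    ((happ f).comp ((hfc.comp hσc).clm_apply continuous_const))
    ((happ e).comp (hωc.comp hσc)) ((happ f).comp (hωc.comp hσc))
    (fun p q => hder f e (fun q => σ (p, q)) q
      (by simpa only [one_smul, id] using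
        (((hasDerivAt_id q).smul_const f).const_add (p • e)).const_add a))
    (fun p q => hder e f (fun p => σ (p, q)) p
      (by simpa only [one_smul, id] using
        (((hasDerivAt_id p).smul_const e).add_const (q • f)).const_add a))
  have hleft : boundary (ofMultiplicity (triangleMult a b c) (integrable_triangleMult a b c)) ω =
      ∫ z in pairSimplex,
        ((fderiv ℝ ω (σ z) e fun _ => f) - (fderiv ℝ ω (σ z) f fun _ => e)) := by
    change ofMultiplicity _ (integrable_triangleMult a b c) (TestForm.d 1 ω) = _
    rw [ofMultiplicity_apply, integral_triangleMult_mul, simplex_integral_eq, ← integral_const_mul]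
    congr 1
    ext z
    rw [← Covector.apply_pair, TestForm.d_apply_pair, trianglePar_pair]
  rw [hleft, hgreen]
  have h1 : edge a b ω = ∫ r in (0 : ℝ)..1, ω (σ (r, 0)) fun _ => e := by
    rw [edge_apply]
    congr 1
    ext r
    simp [hσ, AffineMap.lineMap_apply, he, add_comm]
  have h2 : edge a c ω = ∫ r in (0 : ℝ)..1, ω (σ (0, r)) fun _ => f := by
    rw [edge_apply]
    congr 1
    ext r
    simp [hσ, AffineMap.lineMap_apply, hf, add_comm]
  -- Along the hypotenuse the velocity is `c - b = f - e`, and `ω` is linear in it.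
  have h3 : edge b c ω = ∫ r in (0 : ℝ)..1,
      ((ω (σ (1 - r, r)) fun _ => f) - (ω (σ (1 - r, r)) fun _ => e)) := by
    rw [edge_apply]
    congr 1
    ext r
    have hx : AffineMap.lineMap b c r = σ (1 - r, r) := by
      simp only [hσ, AffineMap.lineMap_apply, he, hf, vsub_eq_sub, vadd_eq_add]
      module
    rw [hx]
    have := (ω (σ (1 - r, r))).map_update_sub (fun _ => f) 0 f e
    have hu : ∀ y : Plane, Function.update (fun _ : Fin 1 => f) 0 y = fun _ => y := by
      intro y
      ext i : 1
      fin_cases i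
      rfl
    rw [hu, hu, hu] at this
    rw [← this]
    congr 1
    ext i : 1
    simp [he, hf]
  change _ = edge a b ω + edge b c ω + edge c a ω
  rw [edge_swap_apply a c, h1, h2, h3]
  ring

/-! ### Mass and flat norm estimates -/

/-- The frame consists of unit vectors, so a form of comass at most one has absolute value at most
one on it. -/
theorem Current.mass_ofMultiplicity_le (f : Plane → ℤ) (hf : Integrable fun x => (f x : ℝ)) :
    mass (ofMultiplicity f hf) ≤ ENNReal.ofReal (∫ x, |(f x : ℝ)|) := by
  refine iSup₂_le fun ω hω => ENNReal.ofReal_le_ofReal ?_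
  rw [ofMultiplicity_apply]
  refine (Real.le_norm_self _).trans (norm_integral_le_of_norm_le hf.abs
    (Filter.Eventually.of_forall fun x => ?_))
  rw [norm_mul, Real.norm_eq_abs (f x : ℝ)]
  refine mul_le_of_le_one_right (abs_nonneg _) ?_
  simpa [frame] using (ω x).le_of_opNorm_le (hω x) frame

theorem integral_abs_triangleMult (a b c : Plane) :
    ∫ x, |(triangleMult a b c x : ℝ)| = |planeCross (b - a) (c - a)| / 2 := by
  set s : ℝ := (SignType.sign (planeCross (b - a) (c - a)) : ℝ) with hs
  -- The multiplicity is `s` or `0`, so its absolute value is its product with the constant `s`, and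
  -- the signed integral formula applies.
  have h : ∀ x, |(triangleMult a b c x : ℝ)| = (triangleMult a b c x : ℝ) * s := by
    intro x
    rw [triangleMult_cast, ← hs]
    by_cases hx : x ∈ solidTriangle a b c
    · rw [Set.indicator_of_mem hx, hs]
      rcases lt_trichotomy (planeCross (b - a) (c - a)) 0 with h | h | h <;> simp [h]
    · simp [hx]
  simp only [h]
  rw [integral_triangleMult_mul a b c fun _ => s]
  have h2 : ∫ _x in planeSimplex, s = s * (1 / 2) := by
    rw [← integral_one_planeSimplex, ← integral_const_mul]
    simp
  rw [h2, ← mul_assoc, mul_comm _ s, hs, sign_mul_self]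
  ring

theorem Current.mass_zero {k : ℕ} : mass (0 : Current k) = 0 := by
  simp [mass]

/-- Restricting the competitors can only raise the infimum. -/
theorem Current.flatNorm_le_integerFlatNorm (lam : ℝ) (T : Current 1) :
    flatNorm lam T ≤ integerFlatNorm lam T :=
  le_iInf₂ fun f hf => iInf_le _ (ofMultiplicity f hf)

theorem Current.ofMultiplicity_add (f g : Plane → ℤ) (hf : Integrable fun x => (f x : ℝ))
    (hg : Integrable fun x => (g x : ℝ)) (hfg : Integrable fun x => ((f x + g x : ℤ) : ℝ)) :
    ofMultiplicity (fun x => f x + g x) hfg = ofMultiplicity f hf + ofMultiplicity g hg := by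
  ext ω
  have h : ∀ f : Plane → ℤ, Integrable (fun x => (f x : ℝ)) →
      Integrable fun x => (f x : ℝ) * ω x frame := by
    intro f hf
    set χ := TestFunction.toBoundedContinuousFunctionCLM ℝ ω
    refine hf.mul_bdd (c := ‖χ‖ * ∏ i, ‖frame i‖)
      ((ContinuousAlternatingMap.apply ℝ Plane ℝ frame).continuous.comp
        χ.continuous).aestronglyMeasurable (Filter.Eventually.of_forall fun x => ?_)
    exact (χ x).le_of_opNorm_le (χ.norm_coe_le_norm x) frame
  change _ = ofMultiplicity f hf ω + ofMultiplicity g hg ω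
  simp only [ofMultiplicity_apply]
  rw [← integral_add (h f hf) (h g hg)]
  congr 1
  ext x
  push_cast
  ring

/-- The flat distance swept out by moving the middle node of a two-edge path. -/
theorem Current.integerFlatNorm_move_le (lam : ℝ) (hlam : 0 ≤ lam) (a v x b : Plane) :
    integerFlatNorm lam (edge a x + edge x b - (edge a v + edge v b)) ≤
      ENNReal.ofReal (lam * dist x v / 2 * (dist a v + dist v b)) := by
  have hf := integrable_triangleMult v a x
  have hg := integrable_triangleMult v x b
  have hfg : Integrable fun y => ((triangleMult v a x y + triangleMult v x b y : ℤ) : ℝ) := by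
    simp only [Int.cast_add]
    exact hf.add hg
  -- The orientations are chosen so that the side between `v` and `x` is traversed once in each
  -- direction.
  refine (iInf₂_le (fun y => triangleMult v a x y + triangleMult v x b y) hfg).trans ?_
  have hb : edge a x + edge x b - (edge a v + edge v b) - boundary (ofMultiplicity _ hfg) = 0 := by
    have : boundary (ofMultiplicity _ hfg) =
        boundary (ofMultiplicity _ hf) + boundary (ofMultiplicity _ hg) := by
      rw [ofMultiplicity_add _ _ hf hg]
      rfl
    rw [this, boundary_triangle, boundary_triangle, edge_swap v a, edge_swap v b, edge_swap v x]
    abel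
  rw [hb, mass_zero, zero_add]
  refine (mul_le_mul_right (mass_ofMultiplicity_le _ hfg) _).trans ?_
  rw [← ENNReal.ofReal_mul hlam]
  refine ENNReal.ofReal_le_ofReal ?_
  rw [mul_div_assoc, mul_assoc]
  refine mul_le_mul_of_nonneg_left ?_ hlam
  -- The triangles may overlap, with equal or opposite signs; subadditivity of the absolute value is
  -- enough.
  have h1 : ∫ y, |((triangleMult v a x y + triangleMult v x b y : ℤ) : ℝ)| ≤
      (∫ y, |(triangleMult v a x y : ℝ)|) + ∫ y, |(triangleMult v x b y : ℝ)| := by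
    rw [← integral_add hf.abs hg.abs]
    refine integral_mono hfg.abs (hf.abs.add hg.abs) fun y => ?_
    push_cast
    exact abs_add_le _ _
  rw [integral_abs_triangleMult, integral_abs_triangleMult] at h1
  have h2 := abs_planeCross_le (a - v) (x - v)
  have h3 := abs_planeCross_le (x - v) (b - v)
  rw [dist_eq_norm x v, dist_eq_norm a v, dist_eq_norm' v b]
  linarith

end

/-! ### The perturbed polyline -/

theorem mainTheorem1 {n : ℕ} (hn : 2 ≤ n) {s t : Plane} (T₀ T₁ : PWL n s t) (hcopy : T₁ = T₀)
    (lam δ : ℝ) (hlam : 0 < lam) (hδ : 0 < δ)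
    (u v w : Fin (n + 1)) (huv : (u : ℕ) + 1 = v) (hvw : (v : ℕ) + 1 = w)
    (v' : Plane) (hv' : v' ∈ T₁.allowedRegion u v w δ) :
    Current.flatNorm lam (T₁.perturbedCurrent v v' - T₀.toCurrent)
        ≤ ENNReal.ofReal
            (lam * δ / 2 * (T₀.sub u w (Fin.le_def.2 (by omega))).length) ∧
      Current.integerFlatNorm lam (T₁.perturbedCurrent v v' - T₀.toCurrent)
        ≤ ENNReal.ofReal
            (lam * δ / 2 * (T₀.sub u w (Fin.le_def.2 (by omega))).length) := by
  subst hcopy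
  suffices h : Current.integerFlatNorm lam (T₁.perturbedCurrent v v' - T₁.toCurrent)
        ≤ ENNReal.ofReal
            (lam * δ / 2 * (T₁.sub u w (Fin.le_def.2 (by omega))).length) from
    ⟨(Current.flatNorm_le_integerFlatNorm _ _).trans h, h⟩
  have hlen : (T₁.sub u w (Fin.le_def.2 (by omega))).length =
      dist (T₁.node u) (T₁.node v) + dist (T₁.node v) (T₁.node w) := by
    -- The edge count `w - u` equals `2` only propositionally, so it is generalized before
    -- substitution.
    have key : ∀ (m : ℕ) (hm : m = 2) (f : Fin (m + 1) → Plane),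
        ∑ i : Fin m, dist (f i.castSucc) (f i.succ) =
          dist (f ⟨0, by omega⟩) (f ⟨1, by omega⟩) + dist (f ⟨1, by omega⟩) (f ⟨2, by omega⟩) := by
      rintro m rfl f
      rw [Fin.sum_univ_two]
      rfl
    rw [PWL.length, key _ (by omega)]
    have e0 : (⟨u + 0, by omega⟩ : Fin (n + 1)) = u := Fin.ext rfl
    have e1 : (⟨u + 1, by omega⟩ : Fin (n + 1)) = v := Fin.ext huv
    have e2 : (⟨u + 2, by omega⟩ : Fin (n + 1)) = w := Fin.ext (by simp only; omega)
    simp only [PWL.sub, e0, e1, e2]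
  have hdiff : T₁.perturbedCurrent v v' - T₁.toCurrent =
      Current.edge (T₁.node u) v' + Current.edge v' (T₁.node w) -
        (Current.edge (T₁.node u) (T₁.node v) + Current.edge (T₁.node v) (T₁.node w)) := by
    have hw := w.isLt
    obtain ⟨i, hi⟩ : ∃ i : Fin n, (i : ℕ) = u := ⟨⟨u, by omega⟩, rfl⟩
    obtain ⟨j, hj⟩ : ∃ j : Fin n, (j : ℕ) = v := ⟨⟨v, by omega⟩, rfl⟩
    have hij : i ≠ j := fun h => by
      have := congrArg Fin.val h
      omega
    have ei0 : i.castSucc = u := Fin.ext hi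
    have ei1 : i.succ = v := Fin.ext (by simp only [Fin.val_succ]; omega)
    have ej0 : j.castSucc = v := Fin.ext hj
    have ej1 : j.succ = w := Fin.ext (by simp only [Fin.val_succ]; omega)
    have huv' : u ≠ v := fun h => by
      have := congrArg Fin.val h
      omega
    have hwv' : w ≠ v := fun h => by
      have := congrArg Fin.val h
      omega
    rw [PWL.perturbedCurrent, PWL.toCurrent, Current.polyline, Current.polyline,
      ← Finset.sum_sub_distrib, ← Finset.sum_subset (Finset.subset_univ {i, j}),
      Finset.sum_pair hij, ei0, ei1, ej0, ej1]
    · simp only [Function.update_self, Function.update_of_ne huv', Function.update_of_ne hwv']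
      abel
    -- An edge other than `i` and `j` does not have `v` as an endpoint, so it cancels.
    · intro k _ hk
      simp only [Finset.mem_insert, Finset.mem_singleton, not_or] at hk
      have hk0 : k.castSucc ≠ v := fun h => hk.2 (Fin.castSucc_injective n (h.trans ej0.symm))
      have hk1 : k.succ ≠ v := fun h => hk.1 (Fin.succ_injective n (h.trans ei1.symm))
      rw [Function.update_of_ne hk0, Function.update_of_ne hk1, sub_self]
  rw [hdiff, hlen]
  refine (Current.integerFlatNorm_move_le lam hlam.le _ _ _ _).trans
    (ENNReal.ofReal_le_ofReal ?_)
  have hd : dist v' (T₁.node v) ≤ δ := (Metric.mem_ball.1 hv'.1).le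
  gcongr
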